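/- For $n\ge 0$ let $C_{2^n}=\{z\in\mathbb C: z^{2^n}=1\}$, let $\mathbb H$ be the algebra of real quaternions, which contains $\mathbb C$ as the subalgebra $\{x+yi : x,y\in\mathbb R\}$, and let $Q_8=\{\pm1,\pm i,\pm j,\pm k\}\subset\mathbb H$. For $n\ge 1$ let $Q_{2^n}$ be the subgroup of the multiplicative group $\mathbb H\setminus\{0\}$ generated by $C_{2^{n-1}}\cup Q_8$, and let $Q_{2^\infty}=\bigcup_{n\ge1}Q_{2^n}$ be the infinite group of generalized quaternions. Let $G$ be an infinite non-abelian group in which the order of every element is a power of $2$ and which contains exactly one element of order $2$. Then $G$ is isomorphic to $Q_{2^\infty}$. -/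

import Mathlib

open scoped Quaternion

noncomputable section

/-- The cyclic group `C_{2^n} = {z ∈ ℂ : z^(2^n) = 1}`, as a set of complex numbers. -/
def cyclicTwoPow (n : ℕ) : Set ℂ := {z | z ^ 2 ^ n = 1}

/-- The quaternion unit `i` (coordinates with respect to `1, i, j, k`). -/
def quaternionI : ℍ[ℝ] := ⟨0, 1, 0, 0⟩

/-- The quaternion unit `j`. -/
def quaternionJ : ℍ[ℝ] := ⟨0, 0, 1, 0⟩

/-- The quaternion unit `k`. -/
def quaternionK : ℍ[ℝ] := ⟨0, 0, 0, 1⟩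

/-- The set `Q_8` of the eight quaternions `±1, ±i, ±j, ±k`. -/
def quaternionEight : Set ℍ[ℝ] :=
  {1, -1, quaternionI, -quaternionI, quaternionJ, -quaternionJ, quaternionK, -quaternionK}

/-- The group of generalized quaternions `Q_{2^n}`, for `n ≥ 1`: the subgroup of the multiplicative
group of the quaternions generated by `C_{2^(n-1)} ∪ Q_8`, where `ℂ` is embedded in the quaternions
by `Quaternion.coeComplex`, that is `x + y i ↦ x + y i`. -/
def generalizedQuaternion (n : ℕ) : Subgroup (ℍ[ℝ])ˣ :=
  Subgroup.closure
    {u | (u : ℍ[ℝ]) ∈ Quaternion.coeComplex '' cyclicTwoPow (n - 1) ∪ quaternionEight}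

theorem generalizedQuaternion_mono {m n : ℕ} (h : m ≤ n) :
    generalizedQuaternion m ≤ generalizedQuaternion n := by
  refine Subgroup.closure_mono ?_
  rintro u (⟨z, hz, hu⟩ | hu)
  · refine Or.inl ⟨z, ?_, hu⟩
    have hd : 2 ^ (m - 1) ∣ 2 ^ (n - 1) := pow_dvd_pow 2 (by omega)
    obtain ⟨c, hc⟩ := hd
    have hz' : z ^ 2 ^ (m - 1) = 1 := hz
    show z ^ 2 ^ (n - 1) = 1
    rw [hc, pow_mul, hz', one_pow]
  · exact Or.inr hu

/-- The infinite group of generalized quaternions `Q_{2^∞}`: the union of the groups `Q_{2^n}`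
over all `n ≥ 1`. -/
def infiniteGeneralizedQuaternion : Subgroup (ℍ[ℝ])ˣ where
  carrier := {u | ∃ n : ℕ, 1 ≤ n ∧ u ∈ generalizedQuaternion n}
  one_mem' := ⟨1, le_rfl, one_mem _⟩
  mul_mem' := by
    rintro a b ⟨m, hm, ha⟩ ⟨n, _, hb⟩
    exact ⟨max m n, le_trans hm (le_max_left m n),
      mul_mem (generalizedQuaternion_mono (le_max_left m n) ha)
        (generalizedQuaternion_mono (le_max_right m n) hb)⟩
  inv_mem' := by
    rintro a ⟨n, hn, ha⟩
    exact ⟨n, hn, inv_mem ha⟩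

end

/-! The involution `z` is central and lies in every nontrivial cyclic subgroup; write `-u` for `z *
u`. The basic rigidity is `eq_or_eq_mul_of_sq_eq`: if `u² = v²` and `u⁴ ≠ 1`, then `u = ±v`. It
implies that squares of two elements of order eight never anticommute (`false_of_sq_conj`), and from
this some `x` of order four generates a normal subgroup (`exists_normal_four`).

Let `C` be the centralizer of `x`, of index at most two. By the same rigidity, elements of `C` of
equal order generate the same cyclic subgroup. Hence `C` is abelian, so proper, and being infinite
it is a Prüfer group. Any `g` outside `C` satisfies `g² = z` and inverts `C`.

These relations fix the multiplication and the equality of the normal forms `a n ^ k * g ^ b`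
independently of the group. In the quaternions they hold for `exp (2πi / 2 ^ n)` and `j`, so the two
groups are isomorphic. -/

/-! ### Elements of order four and eight in a 2-group with one involution -/

/-- `z` is a nontrivial element with `z ^ 2 = 1`, and there is no other one. -/
structure IsUniqueInvolution {G : Type*} [Group G] (z : G) : Prop where
  ne_one : z ≠ 1
  sq : z ^ 2 = 1
  eq_or : ∀ t : G, t ^ 2 = 1 → t = 1 ∨ t = z

namespace IsUniqueInvolution

variable {G : Type*} [Group G] {z : G}

theorem commute (hz : IsUniqueInvolution z) (t : G) : Commute z t := by
  have h : (t * z * t⁻¹) ^ 2 = 1 := by rw [conj_pow, hz.sq]; group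
  rcases hz.eq_or _ h with h | h
  · exact absurd (conj_eq_one_iff.1 h) hz.ne_one
  · exact (mul_inv_eq_iff_eq_mul.1 h).symm

theorem mul_self (hz : IsUniqueInvolution z) : z * z = 1 := by
  rw [← pow_two, hz.sq]

/-- If `s` has order `2 ^ k`, then `k > j` and `s ^ 2 ^ (k - 1)` is the involution. -/
theorem exists_pow_pow_eq (hz : IsUniqueInvolution z) (h2 : IsPGroup 2 G) {s : G} {j : ℕ}
    (hs : s ^ 2 ^ j ≠ 1) : ∃ m : ℕ, (s ^ m) ^ 2 ^ j = z := by
  obtain ⟨k, hk⟩ := IsPGroup.iff_orderOf.1 h2 s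
  have hjk : j < k := by
    by_contra h
    exact hs (orderOf_dvd_iff_pow_eq_one.1 (hk ▸ pow_dvd_pow 2 (not_lt.1 h)))
  refine ⟨2 ^ (k - 1 - j), ?_⟩
  rw [← pow_mul, ← pow_add, show k - 1 - j + j = k - 1 by omega]
  refine (hz.eq_or _ ?_).resolve_left fun h => ?_
  · rw [← pow_mul, ← pow_succ, show k - 1 + 1 = k by omega, ← hk, pow_orderOf_eq_one]
  · have := orderOf_dvd_of_pow_eq_one h
    rw [hk, Nat.pow_dvd_pow_iff_le_right (by norm_num)] at this
    omega

theorem exists_pow_sq_eq (hz : IsUniqueInvolution z) (h2 : IsPGroup 2 G) {s : G}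
    (hs : s ^ 2 ≠ 1) : ∃ m : ℕ, (s ^ m) ^ 2 = z := by
  simpa using hz.exists_pow_pow_eq h2 (s := s) (j := 1) (by simpa using hs)

theorem exists_pow_pow_four_eq (hz : IsUniqueInvolution z) (h2 : IsPGroup 2 G) {s : G}
    (hs : s ^ 4 ≠ 1) : ∃ m : ℕ, (s ^ m) ^ 4 = z := by
  simpa using hz.exists_pow_pow_eq h2 (s := s) (j := 2) (by simpa using hs)

theorem conj_pow_eq_inv {u s : G} (h : u * s * u⁻¹ = s⁻¹) (m : ℕ) :
    u * s ^ m * u⁻¹ = (s ^ m)⁻¹ := by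
  rw [← conj_pow, h, inv_pow]

theorem conj_mul_inv_eq_inv {u v : G} (h : u ^ 2 = v ^ 2) :
    u * (u * v⁻¹) * u⁻¹ = (u * v⁻¹)⁻¹ := by
  have : u * (u * v⁻¹) * u⁻¹ = u ^ 2 * v⁻¹ * u⁻¹ := by rw [pow_two]; group
  rw [this, h]; group

theorem not_commute_of_inv (hz : IsUniqueInvolution z) {u q : G} (h : u * q * u⁻¹ = q⁻¹)
    (hq : q ^ 2 = z) : ¬ Commute u q := by
  intro hc
  rw [hc.eq, mul_inv_cancel_right, eq_inv_iff_mul_eq_one, ← pow_two, hq] at h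
  exact hz.ne_one h

/-- Commuting elements of order four agree up to the involution. -/
theorem eq_or_eq_mul_of_commute (hz : IsUniqueInvolution z) {q x : G} (hq : q ^ 2 = z)
    (hx : x ^ 2 = z) (hc : Commute q x) : q = x ∨ q = z * x := by
  have h : (q * x⁻¹) ^ 2 = 1 := by
    rw [hc.inv_right.mul_pow, hq, inv_pow, hx, mul_inv_cancel]
  rcases hz.eq_or _ h with h | h
  · exact .inl (mul_inv_eq_one.1 h)
  · exact .inr (mul_inv_eq_iff_eq_mul.1 h)

/-- Otherwise some power `q` of `u * v⁻¹` has square `z`. It is inverted by `u`, yet commutes with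
`u² = v²`. A power of `u²` also has square `z`, so `q` agrees with it up to sign and commutes with
`u`, a contradiction. -/
theorem eq_or_eq_mul_of_sq_eq (hz : IsUniqueInvolution z) (h2 : IsPGroup 2 G) {u v : G}
    (h : u ^ 2 = v ^ 2) (hu : u ^ 4 ≠ 1) : u = v ∨ u = z * v := by
  by_cases hs : (u * v⁻¹) ^ 2 = 1
  · rcases hz.eq_or _ hs with h | h
    · exact .inl (mul_inv_eq_one.1 h)
    · exact .inr (mul_inv_eq_iff_eq_mul.1 h)
  exfalso
  obtain ⟨m, hm⟩ := hz.exists_pow_sq_eq h2 hs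
  obtain ⟨l, hl⟩ := hz.exists_pow_sq_eq h2 (s := u ^ 2) (by rwa [← pow_mul])
  have hcu : Commute (u ^ 2) u := Commute.pow_self u 2
  have hcv : Commute (u ^ 2) v := h ▸ Commute.pow_self v 2
  have hqx : Commute ((u * v⁻¹) ^ m) ((u ^ 2) ^ l) :=
    (((hcu.mul_right hcv.inv_right).pow_right m).pow_left l).symm
  refine hz.not_commute_of_inv (conj_pow_eq_inv (conj_mul_inv_eq_inv h) m) hm ?_
  rcases hz.eq_or_eq_mul_of_commute hm hl hqx with e | e <;> rw [e]
  · exact (hcu.pow_left l).symm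
  · exact (hz.commute u).symm.mul_right (hcu.pow_left l).symm

/-- The elements `c * a * c⁻¹` and `a⁻¹` have the same square, so they agree up to `z`. The wrong
sign gives `(c * a)² = 1`, and then `c` commutes with `a`. -/
theorem conj_eq_inv_of_conj_sq (hz : IsUniqueInvolution z) (h2 : IsPGroup 2 G) {a c : G}
    (ha : a ^ 4 = z) (hc : c ^ 2 = z) (h : c * a ^ 2 * c⁻¹ = (a ^ 2)⁻¹) :
    c * a * c⁻¹ = a⁻¹ := by
  have hsq : (c * a * c⁻¹) ^ 2 = a⁻¹ ^ 2 := by rw [conj_pow, h, inv_pow]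
  have h4 : (c * a * c⁻¹) ^ 4 ≠ 1 := by
    rw [conj_pow, ha, Ne, conj_eq_one_iff]; exact hz.ne_one
  refine (hz.eq_or_eq_mul_of_sq_eq h2 hsq h4).resolve_right fun e => ?_
  have h1 : (c * a) ^ 2 = 1 := by
    calc (c * a) ^ 2 = (c * a * c⁻¹) * c ^ 2 * a := by simp only [pow_two]; group
      _ = z * (a⁻¹ * z) * a := by rw [e, hc]; group
      _ = 1 := by rw [← (hz.commute a⁻¹).eq, ← mul_assoc, hz.mul_self]; group
  refine hz.not_commute_of_inv h (by rw [← pow_mul, ha]) ?_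
  have hca : Commute c a := by
    rcases hz.eq_or _ h1 with e | e
    · rw [eq_inv_of_mul_eq_one_left e]; exact (Commute.refl a).inv_left
    · rw [eq_mul_inv_of_mul_eq e]; exact (hz.commute a).mul_left (Commute.refl a).inv_left
  exact hca.pow_right 2

theorem conj_swap (hz : IsUniqueInvolution z) {x c : G} (hx : x ^ 2 = z) (hc : c ^ 2 = z)
    (h : x * c * x⁻¹ = c⁻¹) : c * x * c⁻¹ = x⁻¹ := by
  have h1 : c * x = x * c⁻¹ := by
    rw [← h]
    have : x * (x * c * x⁻¹) = x ^ 2 * c * x⁻¹ := by rw [pow_two]; group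
    rw [this, hx, (hz.commute c).eq, ← hx]; group
  have h3 : c⁻¹ * c⁻¹ = z := by
    rw [← mul_inv_rev, ← pow_two, hc, inv_eq_iff_mul_eq_one, hz.mul_self]
  rw [h1, mul_assoc, h3, eq_inv_iff_mul_eq_one, mul_assoc, (hz.commute x).eq, ← mul_assoc,
    ← pow_two, hx, hz.mul_self]

/-- The product of square roots of two anticommuting elements of order four would act on the
quaternion group they generate as an automorphism of order three. -/
theorem false_of_sq_conj (hz : IsUniqueInvolution z) (h2 : IsPGroup 2 G) {a d : G}
    (ha : a ^ 4 = z) (hd : d ^ 4 = z) (h : a ^ 2 * d ^ 2 * (a ^ 2)⁻¹ = (d ^ 2)⁻¹) : False := by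
  have hx : (a ^ 2) ^ 2 = z := by rw [← pow_mul, ha]
  have hc : (d ^ 2) ^ 2 = z := by rw [← pow_mul, hd]
  have hca := hz.conj_eq_inv_of_conj_sq h2 ha hc (hz.conj_swap hx hc h)
  have hxd := hz.conj_eq_inv_of_conj_sq h2 hd hx h
  have hnc := hz.not_commute_of_inv h hc
  set x := a ^ 2 with hxdef
  set c := d ^ 2 with hcdef
  have e1 : d * x = x * d⁻¹ := by
    have : x * d = d⁻¹ * x := mul_inv_eq_iff_eq_mul.1 hxd
    rw [eq_mul_inv_iff_mul_eq, mul_assoc, this, mul_inv_cancel_left]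
  have e2 : a * c = c * a⁻¹ := by
    have : c * a = a⁻¹ * c := mul_inv_eq_iff_eq_mul.1 hca
    rw [eq_mul_inv_iff_mul_eq, mul_assoc, this, mul_inv_cancel_left]
  have g2 : (a * d) * c * (a * d)⁻¹ = c * x⁻¹ := by
    calc (a * d) * c * (a * d)⁻¹ = a * c * a⁻¹ := by rw [hcdef]; group
      _ = c * x⁻¹ := by rw [e2, hxdef]; group
  have g1 : (a * d) * x * (a * d)⁻¹ = c := by
    calc (a * d) * x * (a * d)⁻¹ = a * (d * x) * d⁻¹ * a⁻¹ := by group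
      _ = x * (a * c * a⁻¹)⁻¹ := by rw [e1, hxdef, hcdef]; group
      _ = x ^ 2 * c⁻¹ := by rw [e2, hxdef]; group
      _ = c := by rw [hx, ← hc]; group
  have g3 : (a * d) * (c * x⁻¹) * (a * d)⁻¹ = x := by
    calc (a * d) * (c * x⁻¹) * (a * d)⁻¹
        = ((a * d) * c * (a * d)⁻¹) * ((a * d) * x * (a * d)⁻¹)⁻¹ := by group
      _ = c * x⁻¹ * c⁻¹ := by rw [g1, g2]
      _ = (c * x * c⁻¹)⁻¹ := by group
      _ = x := by rw [hz.conj_swap hx hc h, inv_inv]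
  -- Conjugation by `a * d` permutes `x`, `c`, `c * x⁻¹` cyclically. As `a * d` has order prime to
  -- three, it is a power of its cube and so fixes `x` too, forcing `x = c`.
  have hcomm : Commute ((a * d) ^ 3) x := by
    have : (a * d) ^ 3 * x * ((a * d) ^ 3)⁻¹ = x := by
      calc (a * d) ^ 3 * x * ((a * d) ^ 3)⁻¹
          = (a * d) * ((a * d) * ((a * d) * x * (a * d)⁻¹) * (a * d)⁻¹) * (a * d)⁻¹ := by
            rw [pow_succ, pow_two]; group
        _ = x := by rw [g1, g2, g3]
    exact mul_inv_eq_iff_eq_mul.1 this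
  obtain ⟨k, hk⟩ := IsPGroup.iff_orderOf.1 h2 (a * d)
  obtain ⟨m, hm⟩ := exists_pow_eq_self_of_coprime (x := a * d) (n := 3)
    (by rw [hk]; exact Nat.Coprime.pow_right k (by norm_num))
  have hcomm' : Commute (a * d) x := hm ▸ hcomm.pow_left m
  rw [hcomm'.eq, mul_inv_cancel_right] at g1
  exact hnc (g1 ▸ Commute.refl x)

/-- Two elements of order four either normalize each other or generate a group in which the first
one inverts an element of order eight. -/
theorem conj_eq_or_exists (hz : IsUniqueInvolution z) (h2 : IsPGroup 2 G) {x y : G}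
    (hx : x ^ 2 = z) (hy : y ^ 2 = z) :
    y * x * y⁻¹ = x ∨ y * x * y⁻¹ = x⁻¹ ∨
      ∃ d : G, d ^ 4 = z ∧ x * d ^ 2 * x⁻¹ = (d ^ 2)⁻¹ := by
  have hs := conj_mul_inv_eq_inv (hx.trans hy.symm)
  by_cases h4 : (x * y⁻¹) ^ 4 = 1
  · have h22 : ((x * y⁻¹) ^ 2) ^ 2 = 1 := by rw [← pow_mul, h4]
    rcases hz.eq_or _ h22 with h | h
    · left
      rcases hz.eq_or _ h with h | h
      · rw [mul_inv_eq_one.1 h]; group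
      · rw [mul_inv_eq_iff_eq_mul.1 h, ← mul_assoc, ← (hz.commute y).eq]; group
    · right; left
      refine hz.conj_swap hx hy ?_
      -- Here `s = x * y⁻¹` has square `z` and anticommutes with `x`, hence so does `y = s⁻¹ * x`.
      have hxs := hz.conj_swap hx h hs
      have hyx : y = (x * y⁻¹)⁻¹ * x := by group
      rw [hyx]
      calc x * ((x * y⁻¹)⁻¹ * x) * x⁻¹ = (x * (x * y⁻¹) * x⁻¹)⁻¹ * x := by group
        _ = (x * y⁻¹) * x := by rw [hs, inv_inv]
        _ = x⁻¹ * (x * y⁻¹) := mul_inv_eq_iff_eq_mul.1 hxs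
        _ = _ := by group
  · obtain ⟨m, hm⟩ := hz.exists_pow_pow_four_eq h2 h4
    refine .inr (.inr ⟨_, hm, ?_⟩)
    rw [← pow_mul]
    exact conj_pow_eq_inv hs _

/-- Some element of order four generates a normal subgroup. -/
theorem exists_normal_four (hz : IsUniqueInvolution z) (h2 : IsPGroup 2 G)
    (hna : ¬ ∀ a b : G, a * b = b * a) :
    ∃ x : G, x ^ 2 = z ∧ ∀ g : G, g * x * g⁻¹ = x ∨ g * x * g⁻¹ = x⁻¹ := by
  by_cases h8 : ∃ a : G, a ^ 4 = z
  · obtain ⟨a, ha⟩ := h8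
    have hx : (a ^ 2) ^ 2 = z := by rw [← pow_mul, ha]
    have key (y : G) (hy : y ^ 2 = z) :
        y * a ^ 2 * y⁻¹ = a ^ 2 ∨ y * a ^ 2 * y⁻¹ = (a ^ 2)⁻¹ := by
      rcases hz.conj_eq_or_exists h2 hx hy with h | h | ⟨d, hd, h⟩
      · exact .inl h
      · exact .inr h
      · exact (hz.false_of_sq_conj h2 ha hd h).elim
    refine ⟨a ^ 2, hx, fun g => ?_⟩
    have hy : (g * a ^ 2 * g⁻¹) ^ 2 = z := by
      rw [conj_pow, hx, ← (hz.commute g).eq, mul_inv_cancel_right]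
    rcases key _ hy with h | h
    · rcases hz.eq_or_eq_mul_of_commute hy hx (mul_inv_eq_iff_eq_mul.1 h) with e | e
      · exact .inl e
      · right
        rw [e, eq_inv_iff_mul_eq_one, mul_assoc, ← pow_two, hx, hz.mul_self]
    -- The conjugate of `a²` is the square of `g * a * g⁻¹`, so it cannot anticommute with `a²`.
    · refine (hz.false_of_sq_conj h2 (a := g * a * g⁻¹) ?_ ha ?_).elim
      · rw [conj_pow, ha, ← (hz.commute g).eq, mul_inv_cancel_right]
      · rw [conj_pow]; exact h
  · have hex : ∃ s : G, s ^ 2 ≠ 1 := by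
      by_contra! h
      exact hna fun a b =>
        (Commute.of_orderOf_dvd_two (fun g => orderOf_dvd_of_pow_eq_one (h g)) a b).eq
    obtain ⟨s, hs⟩ := hex
    obtain ⟨m, hm⟩ := hz.exists_pow_sq_eq h2 hs
    refine ⟨s ^ m, hm, fun g => ?_⟩
    by_cases hg : g ^ 2 = 1
    · left
      rcases hz.eq_or _ hg with rfl | rfl
      · group
      · rw [(hz.commute _).eq, mul_inv_cancel_right]
    · have hg4 : (g ^ 2) ^ 2 = 1 := by
        by_contra h
        rw [← pow_mul] at h
        obtain ⟨l, hl⟩ := hz.exists_pow_pow_four_eq h2 h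
        exact h8 ⟨_, hl⟩
      rcases hz.conj_eq_or_exists h2 hm ((hz.eq_or _ hg4).resolve_left hg) with h | h | ⟨d, hd, -⟩
      · exact .inl h
      · exact .inr h
      · exact (h8 ⟨d, hd⟩).elim

/-! ### The centralizer of an element of order four -/

/-- Induction through squares: `u² = (v ^ k)²` gives `u = ±v ^ k` from order eight on. In order four
this rigidity fails, and `x` replaces it: both elements are `±x`. -/
theorem mem_zpowers_of_orderOf_eq (hz : IsUniqueInvolution z) (h2 : IsPGroup 2 G) {x : G}
    (hx : x ^ 2 = z) (m : ℕ) : ∀ u v : G, Commute u x → Commute v x → orderOf u = 2 ^ m →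
      orderOf v = 2 ^ m → u ∈ Subgroup.zpowers v := by
  have sq_order {w : G} {n : ℕ} (hw : orderOf w = 2 ^ (n + 1)) : orderOf (w ^ 2) = 2 ^ n := by
    rw [orderOf_pow_of_dvd two_ne_zero (hw ▸ dvd_pow_self 2 (by omega)), hw, pow_succ]
    simp
  have eqz {w : G} (hw : orderOf w = 2) : w = z := by
    refine (hz.eq_or w (hw ▸ pow_orderOf_eq_one w)).resolve_left fun h => ?_
    rw [h, orderOf_one] at hw; omega
  induction m with
  | zero =>
    intro u v _ _ hu _
    rw [pow_zero, orderOf_eq_one_iff] at hu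
    exact hu ▸ one_mem _
  | succ m ih =>
    intro u v hux hvx hu hv
    have hzv : z ∈ Subgroup.zpowers v := by
      refine Subgroup.mem_zpowers_iff.2 ⟨((2 ^ m : ℕ) : ℤ), ?_⟩
      rw [zpow_natCast]
      refine eqz ?_
      rw [orderOf_pow_of_dvd (by positivity) (hv ▸ pow_dvd_pow 2 (by omega)), hv, pow_succ]
      simp
    have hvv := Subgroup.mem_zpowers v
    suffices h : ∃ y ∈ Subgroup.zpowers v, u = y ∨ u = z * y by
      obtain ⟨y, hy, rfl | rfl⟩ := h
      · exact hy
      · exact mul_mem hzv hy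
    match m, ih with
    | 0, _ => exact ⟨v, hvv, .inl ((eqz (by simpa using hu)).trans (eqz (by simpa using hv)).symm)⟩
    | 1, _ =>
      have hu2 : u ^ 2 = z := eqz (by simpa using sq_order hu)
      have hv2 : v ^ 2 = z := eqz (by simpa using sq_order hv)
      refine ⟨v, hvv, hz.eq_or_eq_mul_of_commute hu2 hv2 ?_⟩
      rcases hz.eq_or_eq_mul_of_commute hv2 hx hvx with rfl | rfl
      · exact hux
      · exact (hz.commute u).symm.mul_right hux
    | m + 2, ih =>
      obtain ⟨k, hk⟩ := Subgroup.mem_zpowers_iff.1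
        (ih _ _ (hux.pow_left 2) (hvx.pow_left 2) (sq_order hu) (sq_order hv))
      refine ⟨v ^ k, Subgroup.zpow_mem _ hvv k, hz.eq_or_eq_mul_of_sq_eq h2 ?_ fun h => ?_⟩
      · rw [← hk, ← zpow_natCast, ← zpow_natCast, ← zpow_mul, ← zpow_mul, mul_comm]
      · have := orderOf_dvd_of_pow_eq_one h
        rw [hu, show (4 : ℕ) = 2 ^ 2 by norm_num,
          Nat.pow_dvd_pow_iff_le_right (by norm_num)] at this
        omega

theorem mem_zpowers_of_le (hz : IsUniqueInvolution z) (h2 : IsPGroup 2 G) {x : G}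
    (hx : x ^ 2 = z) {m n : ℕ} (hmn : m ≤ n) {u v : G} (hux : Commute u x) (hvx : Commute v x)
    (hu : orderOf u = 2 ^ m) (hv : orderOf v = 2 ^ n) :
    u ∈ Subgroup.zpowers (v ^ 2 ^ (n - m)) := by
  refine hz.mem_zpowers_of_orderOf_eq h2 hx m _ _ hux (hvx.pow_left _) hu ?_
  rw [orderOf_pow_of_dvd (by positivity) (hv ▸ pow_dvd_pow 2 (by omega)), hv,
    Nat.pow_div (by omega) (by norm_num)]
  congr 1; omega

theorem commute_of_commute (hz : IsUniqueInvolution z) (h2 : IsPGroup 2 G) {x : G}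
    (hx : x ^ 2 = z) {u v : G} (hux : Commute u x) (hvx : Commute v x) : Commute u v := by
  obtain ⟨m, hm⟩ := IsPGroup.iff_orderOf.1 h2 u
  obtain ⟨n, hn⟩ := IsPGroup.iff_orderOf.1 h2 v
  wlog hmn : m ≤ n generalizing u v m n
  · exact (this hvx hux n hn m hm (by omega)).symm
  obtain ⟨k, rfl⟩ := Subgroup.mem_zpowers_iff.1 (hz.mem_zpowers_of_le h2 hx hmn hux hvx hm hn)
  exact ((Commute.refl v).pow_left _).zpow_left k

/-- In an infinite centralizer of an element of order four, every element is a square. -/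
theorem exists_sq_eq (hz : IsUniqueInvolution z) (h2 : IsPGroup 2 G) {x : G}
    (hx : x ^ 2 = z) (hinf : {u : G | Commute u x}.Infinite) {u : G} (hu : Commute u x) :
    ∃ v : G, Commute v x ∧ v ^ 2 = u := by
  by_contra! hns
  obtain ⟨m, hm⟩ := IsPGroup.iff_orderOf.1 h2 u
  have hfin : (Subgroup.zpowers u : Set G).Finite :=
    isOfFinOrder_iff_pow_eq_one.2 ⟨2 ^ m, by positivity, hm ▸ pow_orderOf_eq_one u⟩ |>.finite_zpowers
  -- An element `v` of larger order than `u` would make `u` a power of an even power of `v`, hence a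
  -- square. So the centralizer would lie in the finite group generated by `u`.
  refine hinf (hfin.subset fun v (hv : Commute v x) => ?_)
  obtain ⟨n, hn⟩ := IsPGroup.iff_orderOf.1 h2 v
  rcases le_or_gt n m with hnm | hnm
  · exact Subgroup.zpowers_le.2 (Subgroup.npow_mem_zpowers _ _)
      (hz.mem_zpowers_of_le h2 hx hnm hv hu hn hm)
  · obtain ⟨k, hk⟩ := Subgroup.mem_zpowers_iff.1 (hz.mem_zpowers_of_le h2 hx hnm.le hu hv hm hn)
    refine (hns ((v ^ 2 ^ (n - m - 1)) ^ k) ((hv.pow_left _).zpow_left k) ?_).elim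
    rw [← hk, ← zpow_natCast, ← zpow_mul, mul_comm, zpow_mul, zpow_natCast, ← pow_mul, ← pow_succ,
      show n - m - 1 + 1 = n - m by omega]

end IsUniqueInvolution

/-! ### Normal forms and uniqueness of the infinite quaternion group -/

/-- The sequence `a` consists of compatible generators of the cyclic groups of order `2 ^ n` in a
Prüfer group, which `g` inverts and extends to the whole group, with `g ^ 2` the involution. -/
structure IsInfiniteQuaternion {G : Type*} [Group G] (a : ℕ → G) (g : G) : Prop where
  zero : a 0 = 1
  succ_sq : ∀ n, a (n + 1) ^ 2 = a n
  one_ne : a 1 ≠ 1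
  mul_eq : ∀ n, g * a n = (a n)⁻¹ * g
  sq_eq : g * g = a 1
  exists_eq : ∀ x : G, ∃ (n : ℕ) (k : ℤ), x = a n ^ k ∨ x = a n ^ k * g

namespace IsInfiniteQuaternion

variable {G : Type*} [Group G] {a : ℕ → G} {g : G}

theorem pow_eq_of_succ_sq (h : ∀ n, a (n + 1) ^ 2 = a n) (n m : ℕ) : a (n + m) ^ 2 ^ m = a n := by
  induction m with
  | zero => simp
  | succ m ih => rw [pow_succ', pow_mul, ← add_assoc, h, ih]

theorem zpow_eq_of_succ_sq (h : ∀ n, a (n + 1) ^ 2 = a n) (n m : ℕ) (k : ℤ) :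
    a n ^ k = a (n + m) ^ (2 ^ m * k) := by
  rw [zpow_mul, ← pow_eq_of_succ_sq h n m]
  norm_cast

theorem orderOf_eq_of_succ_sq (h0 : a 0 = 1) (h : ∀ n, a (n + 1) ^ 2 = a n) (h1 : a 1 ≠ 1)
    (n : ℕ) : orderOf (a n) = 2 ^ n := by
  cases n with
  | zero => simp [h0]
  | succ n =>
    refine orderOf_eq_prime_pow ?_ ?_
    · rwa [add_comm n 1, pow_eq_of_succ_sq h]
    · have := pow_eq_of_succ_sq h 0 (n + 1)
      rwa [zero_add, h0] at this

theorem zpow_eq_zpow_iff (h : IsInfiniteQuaternion a g) (n m : ℕ) (k l : ℤ) :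
    a n ^ k = a m ^ l ↔ (2 ^ (n + m) : ℤ) ∣ 2 ^ m * k - 2 ^ n * l := by
  rw [zpow_eq_of_succ_sq h.succ_sq n m k, zpow_eq_of_succ_sq h.succ_sq m n l, add_comm m n,
    ← mul_inv_eq_one, ← zpow_neg, ← zpow_add, ← sub_eq_add_neg, ← orderOf_dvd_iff_zpow_eq_one,
    orderOf_eq_of_succ_sq h.zero h.succ_sq h.one_ne]
  norm_cast

theorem mul_zpow_eq (h : IsInfiniteQuaternion a g) (n : ℕ) (k : ℤ) :
    g * a n ^ k = a n ^ (-k) * g := by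
  rw [← mul_inv_eq_iff_eq_mul, ← conj_zpow, mul_inv_eq_iff_eq_mul.2 (h.mul_eq n), inv_zpow, zpow_neg]

theorem zpow_ne_zpow_mul (h : IsInfiniteQuaternion a g) (n m : ℕ) (k l : ℤ) :
    a n ^ k ≠ a m ^ l * g := by
  intro e
  have hc (i j : ℕ) (p q : ℤ) : Commute (a i ^ p) (a j ^ q) := by
    rw [zpow_eq_of_succ_sq h.succ_sq i j, zpow_eq_of_succ_sq h.succ_sq j i, add_comm j i]
    exact (Commute.refl _).zpow_zpow _ _
  -- Such a `g` would commute with all `a i`. The term `a 2`, of order four, is the first that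
  -- differs from its inverse.
  have hg : g * a 2 ^ (1 : ℤ) = a 2 ^ (1 : ℤ) * g := by
    rw [← inv_mul_eq_iff_eq_mul] at e
    rw [← e]
    exact ((hc m 2 l 1).inv_left.mul_left (hc n 2 k 1)).eq
  rw [h.mul_zpow_eq, mul_left_inj, h.zpow_eq_zpow_iff] at hg
  norm_num at hg

/-- The normal form `a n ^ k * g ^ b` with `b ∈ {0, 1}`. -/
def normalForm (a : ℕ → G) (g : G) (p : ℕ × ℤ × Bool) : G :=
  a p.1 ^ p.2.1 * if p.2.2 then g else 1

/-- The multiplication of normal forms. -/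
def normalFormMul (p q : ℕ × ℤ × Bool) : ℕ × ℤ × Bool :=
  (p.1 + q.1 + 1, 2 ^ (q.1 + 1) * p.2.1 + 2 ^ (p.1 + 1) * (if p.2.2 then -q.2.1 else q.2.1) +
    (if p.2.2 && q.2.2 then 2 ^ (p.1 + q.1) else 0), xor p.2.2 q.2.2)

theorem normalForm_mul (h : IsInfiniteQuaternion a g) (p q : ℕ × ℤ × Bool) :
    normalForm a g p * normalForm a g q = normalForm a g (normalFormMul p q) := by
  obtain ⟨n, k, b⟩ := p
  obtain ⟨m, l, c⟩ := q
  have e1 (k : ℤ) : a n ^ k = a (n + m + 1) ^ (2 ^ (m + 1) * k) :=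
    zpow_eq_of_succ_sq h.succ_sq n (m + 1) k
  have e2 (l : ℤ) : a m ^ l = a (n + m + 1) ^ (2 ^ (n + 1) * l) := by
    rw [zpow_eq_of_succ_sq h.succ_sq m (n + 1) l]; congr 2; omega
  -- The common level is `n + m + 1` rather than `n + m`, so that `g² = a 1` is available even for
  -- `n = m = 0`.
  have e3 : a 1 = a (n + m + 1) ^ ((2 : ℤ) ^ (n + m)) := by
    have := zpow_eq_of_succ_sq h.succ_sq 1 (n + m) 1
    rwa [zpow_one, mul_one, add_comm 1] at this
  cases b <;> cases c <;> simp only [normalForm, normalFormMul, Bool.false_eq_true, if_true,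
    if_false, Bool.and_true, Bool.and_false, Bool.xor_false, Bool.xor_true, Bool.not_true,
    Bool.not_false, mul_one, add_zero, zpow_add]
  · rw [e1, e2]
  · rw [e1, e2, mul_assoc]
  · rw [mul_assoc, h.mul_zpow_eq, e1, e2, mul_assoc]
  · rw [mul_assoc, ← mul_assoc g, h.mul_zpow_eq, mul_assoc, h.sq_eq, ← e3, e1, e2, mul_assoc]

/-- Equality reduces to a divisibility between the integer parameters, which does not involve the
group. -/
theorem normalForm_eq_iff {G' : Type*} [Group G'] {a' : ℕ → G'} {g' : G'}
    (h : IsInfiniteQuaternion a g) (h' : IsInfiniteQuaternion a' g') (p q : ℕ × ℤ × Bool) :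
    normalForm a g p = normalForm a g q ↔ normalForm a' g' p = normalForm a' g' q := by
  obtain ⟨n, k, b⟩ := p
  obtain ⟨m, l, c⟩ := q
  cases b <;> cases c <;> simp [normalForm, h.zpow_eq_zpow_iff, h'.zpow_eq_zpow_iff,
    h.zpow_ne_zpow_mul, h'.zpow_ne_zpow_mul, (h.zpow_ne_zpow_mul _ _ _ _).symm,
    (h'.zpow_ne_zpow_mul _ _ _ _).symm]

theorem normalForm_surjective (h : IsInfiniteQuaternion a g) :
    Function.Surjective (normalForm a g) := by
  intro x
  obtain ⟨n, k, rfl | rfl⟩ := h.exists_eq x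
  · exact ⟨(n, k, false), by simp [normalForm]⟩
  · exact ⟨(n, k, true), by simp [normalForm]⟩

theorem nonempty_mulEquiv {G' : Type*} [Group G'] {a' : ℕ → G'} {g' : G'}
    (h : IsInfiniteQuaternion a g) (h' : IsInfiniteQuaternion a' g') : Nonempty (G ≃* G') := by
  choose s hs using h.normalForm_surjective
  choose s' hs' using h'.normalForm_surjective
  refine ⟨{ toFun := fun x => normalForm a' g' (s x)
            invFun := fun y => normalForm a g (s' y)
            left_inv := fun x => ?_
            right_inv := fun y => ?_
            map_mul' := fun x y => ?_ }⟩
  · refine Eq.trans ?_ (hs x)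
    rw [h.normalForm_eq_iff h', hs']
  · refine Eq.trans ?_ (hs' y)
    rw [h'.normalForm_eq_iff h, hs]
  · rw [h'.normalForm_mul, ← h.normalForm_eq_iff h', ← h.normalForm_mul, hs, hs, hs]

end IsInfiniteQuaternion

/-! ### Structure of the abstract group -/

/-- An infinite non-abelian `2`-group with a unique involution is an extension of a Prüfer group
by an element of order four inverting it. -/
theorem IsUniqueInvolution.exists_isInfiniteQuaternion {G : Type*} [Group G] [Infinite G] {z : G}
    (hz : IsUniqueInvolution z) (h2 : IsPGroup 2 G) (hna : ¬ ∀ a b : G, a * b = b * a) :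
    ∃ (a : ℕ → G) (g : G), IsInfiniteQuaternion a g := by
  obtain ⟨x, hx, hn⟩ := hz.exists_normal_four h2 hna
  obtain ⟨g, hg⟩ : ∃ g : G, ¬ Commute g x := by
    by_contra! h
    exact hna fun a b => (hz.commute_of_commute h2 hx (h a) (h b)).eq
  have hconj {u : G} (hu : ¬ Commute u x) : u * x * u⁻¹ = x⁻¹ :=
    (hn u).resolve_left fun h => hu (mul_inv_eq_iff_eq_mul.1 h)
  have hmem {u : G} (hu : ¬ Commute u x) : Commute (u * g⁻¹) x := by
    have e : g⁻¹ * x * g = x⁻¹ := by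
      rw [← inv_inj, inv_inv]
      calc (g⁻¹ * x * g)⁻¹ = g⁻¹ * x⁻¹ * g := by group
        _ = x := by rw [← hconj hg]; group
    refine mul_inv_eq_iff_eq_mul.1 ?_
    calc u * g⁻¹ * x * (u * g⁻¹)⁻¹ = u * (g⁻¹ * x * g) * u⁻¹ := by group
      _ = (u * x * u⁻¹)⁻¹ := by rw [e]; group
      _ = x := by rw [hconj hu, inv_inv]
  have hinf : {u : G | Commute u x}.Infinite := by
    intro hfin
    refine Set.infinite_univ ((hfin.union (hfin.image (· * g))).subset fun u _ => ?_)
    by_cases hu : Commute u x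
    · exact .inl hu
    · exact .inr ⟨u * g⁻¹, hmem hu, inv_mul_cancel_right u g⟩
  -- If `u⁴ ≠ 1`, a power of `u²` has square `z` and commutes with `x`, so it is `±x`; then `u`
  -- commutes with `x`.
  have hsq {u : G} (hu : ¬ Commute u x) : u ^ 2 = z := by
    have hu2 : u ^ 2 ≠ 1 := fun h => hu <| by
      rcases hz.eq_or _ h with rfl | rfl
      · exact Commute.one_left x
      · exact hz.commute x
    refine (hz.eq_or _ ?_).resolve_left hu2
    by_contra h4
    obtain ⟨m, hm⟩ := hz.exists_pow_sq_eq h2 h4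
    have hc : Commute (u ^ 2) x := by
      refine mul_inv_eq_iff_eq_mul.1 ?_
      calc u ^ 2 * x * (u ^ 2)⁻¹ = u * (u * x * u⁻¹) * u⁻¹ := by rw [pow_two]; group
        _ = u * x⁻¹ * u⁻¹ := by rw [hconj hu]
        _ = (u * x * u⁻¹)⁻¹ := by group
        _ = x := by rw [hconj hu, inv_inv]
    have huu : Commute u ((u ^ 2) ^ m) := ((Commute.refl u).pow_right 2).pow_right m
    rcases hz.eq_or_eq_mul_of_commute hx hm (hc.pow_left m).symm with e | e
    · exact hu (e ▸ huu)
    · exact hu (e ▸ (hz.commute u).symm.mul_right huu)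
  -- Both `g` and `g * u` lie outside the centralizer, so `(g * u)² = z = g²`.
  have hinv {u : G} (hu : Commute u x) : g * u = u⁻¹ * g := by
    have hgu : ¬ Commute (g * u) x := fun h => hg <| by
      simpa using h.mul_left hu.inv_left
    have e : g * (u * g * u) = g * g := by
      calc g * (u * g * u) = (g * u) ^ 2 := by rw [pow_two]; group
        _ = g * g := by rw [hsq hgu, ← hsq hg, pow_two]
    rw [eq_inv_mul_iff_mul_eq, ← mul_assoc]
    exact mul_left_cancel e
  choose r hrx hr using fun u : {u : G // Commute u x} => hz.exists_sq_eq h2 hx hinf u.2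
  let f (u : {u : G // Commute u x}) : {u : G // Commute u x} := ⟨r u, hrx u⟩
  let b (n : ℕ) : {u : G // Commute u x} := f^[n] ⟨z, hz.commute x⟩
  -- The terms from `a 1 = z` on are iterated square roots inside the centralizer.
  let a : ℕ → G := fun n => Nat.casesOn n 1 fun n => (b n : G)
  have hax (n : ℕ) : Commute (a n) x := by
    cases n with
    | zero => exact Commute.one_left x
    | succ n => exact (b n).2
  have h1 : a 1 ≠ 1 := hz.ne_one
  have hs (n : ℕ) : a (n + 1) ^ 2 = a n := by
    cases n with
    | zero => exact hz.sq
    | succ n =>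
      change (b (n + 1) : G) ^ 2 = b n
      simp only [b, Function.iterate_succ_apply']
      exact hr _
  have hpow {u : G} (hu : Commute u x) : ∃ (n : ℕ) (k : ℤ), u = a n ^ k := by
    obtain ⟨n, hn⟩ := IsPGroup.iff_orderOf.1 h2 u
    obtain ⟨k, hk⟩ := Subgroup.mem_zpowers_iff.1 <| hz.mem_zpowers_of_orderOf_eq h2 hx n _ _ hu
      (hax n) hn (IsInfiniteQuaternion.orderOf_eq_of_succ_sq rfl hs h1 n)
    exact ⟨n, k, hk.symm⟩
  refine ⟨a, g, rfl, hs, h1, fun n => hinv (hax n), by rw [← pow_two]; exact hsq hg, fun u => ?_⟩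
  by_cases hu : Commute u x
  · obtain ⟨n, k, h⟩ := hpow hu
    exact ⟨n, k, .inl h⟩
  · obtain ⟨n, k, h⟩ := hpow (hmem hu)
    exact ⟨n, k, .inr (by rw [← h, inv_mul_cancel_right])⟩

/-! ### The quaternion model -/

@[simp] theorem quaternionI_re : quaternionI.re = 0 := rfl
@[simp] theorem quaternionI_imI : quaternionI.imI = 1 := rfl
@[simp] theorem quaternionI_imJ : quaternionI.imJ = 0 := rfl
@[simp] theorem quaternionI_imK : quaternionI.imK = 0 := rfl

@[simp] theorem quaternionJ_re : quaternionJ.re = 0 := rfl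
@[simp] theorem quaternionJ_imI : quaternionJ.imI = 0 := rfl
@[simp] theorem quaternionJ_imJ : quaternionJ.imJ = 1 := rfl
@[simp] theorem quaternionJ_imK : quaternionJ.imK = 0 := rfl

@[simp] theorem quaternionK_re : quaternionK.re = 0 := rfl
@[simp] theorem quaternionK_imI : quaternionK.imI = 0 := rfl
@[simp] theorem quaternionK_imJ : quaternionK.imJ = 0 := rfl
@[simp] theorem quaternionK_imK : quaternionK.imK = 1 := rfl

/-- The embedding of the multiplicative group of `ℂ` into that of the quaternions. -/
noncomputable def complexUnitsToQuaternion : ℂˣ →* (ℍ[ℝ])ˣ :=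
  Units.map (Quaternion.ofComplex : ℂ →* ℍ[ℝ])

theorem coe_complexUnitsToQuaternion (w : ℂˣ) :
    (complexUnitsToQuaternion w : ℍ[ℝ]) = Quaternion.coeComplex w := rfl

theorem complexUnitsToQuaternion_injective : Function.Injective complexUnitsToQuaternion := by
  intro v w h
  have hval := congrArg (Units.val) h
  rw [coe_complexUnitsToQuaternion, coe_complexUnitsToQuaternion] at hval
  ext
  exact Complex.ext (congrArg QuaternionAlgebra.re hval) (congrArg QuaternionAlgebra.imI hval)

/-- The quaternion unit `j` as an element of the multiplicative group. -/
noncomputable def quaternionJUnit : (ℍ[ℝ])ˣ where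
  val := quaternionJ
  inv := -quaternionJ
  val_inv := by ext <;> simp
  inv_val := by ext <;> simp

theorem quaternionJUnit_mul_self :
    quaternionJUnit * quaternionJUnit = complexUnitsToQuaternion (-1) := by
  ext <;> simp [quaternionJUnit, coe_complexUnitsToQuaternion]

/-- Moving `j` past a complex number conjugates it, and on the unit circle conjugation is inversion.
-/
theorem quaternionJUnit_mul {w : ℂˣ} (hw : ‖(w : ℂ)‖ = 1) :
    quaternionJUnit * complexUnitsToQuaternion w =
      complexUnitsToQuaternion w⁻¹ * quaternionJUnit := by
  ext1
  rw [Units.val_mul, Units.val_mul, coe_complexUnitsToQuaternion, coe_complexUnitsToQuaternion,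
    Units.val_inv_eq_inv_val, Complex.inv_eq_conj hw]
  ext <;> simp [quaternionJUnit]

theorem mem_primaryComponent_two_iff {w : ℂˣ} :
    w ∈ CommGroup.primaryComponent ℂˣ 2 ↔ ∃ n : ℕ, w ^ 2 ^ n = 1 :=
  Iff.rfl

theorem norm_eq_one_of_mem_primaryComponent {w : ℂˣ}
    (hw : w ∈ CommGroup.primaryComponent ℂˣ 2) : ‖(w : ℂ)‖ = 1 := by
  obtain ⟨n, hn⟩ := mem_primaryComponent_two_iff.1 hw
  exact Complex.norm_eq_one_of_pow_eq_one (n := 2 ^ n) (by simpa using congrArg Units.val hn)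
    (by positivity)

theorem neg_one_mem_primaryComponent : (-1 : ℂˣ) ∈ CommGroup.primaryComponent ℂˣ 2 :=
  mem_primaryComponent_two_iff.2 ⟨1, by simp⟩

/-- The union of the cosets of `1` and `j` of the group of roots of unity of `2`-power order. -/
noncomputable def twoPowRootsWithJ : Subgroup (ℍ[ℝ])ˣ where
  carrier := {u | ∃ w ∈ CommGroup.primaryComponent ℂˣ 2,
    u = complexUnitsToQuaternion w ∨ u = complexUnitsToQuaternion w * quaternionJUnit}
  one_mem' := ⟨1, one_mem _, .inl (map_one _).symm⟩
  mul_mem' := by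
    rintro _ _ ⟨v, hv, rfl | rfl⟩ ⟨w, hw, rfl | rfl⟩
    · exact ⟨v * w, mul_mem hv hw, .inl (map_mul _ _ _).symm⟩
    · exact ⟨v * w, mul_mem hv hw, .inr (by rw [map_mul, mul_assoc])⟩
    · refine ⟨v * w⁻¹, mul_mem hv (inv_mem hw), .inr ?_⟩
      rw [mul_assoc, quaternionJUnit_mul (norm_eq_one_of_mem_primaryComponent hw), map_mul,
        mul_assoc]
    · refine ⟨v * w⁻¹ * -1, mul_mem (mul_mem hv (inv_mem hw)) neg_one_mem_primaryComponent,
        .inl ?_⟩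
      rw [mul_assoc, ← mul_assoc quaternionJUnit,
        quaternionJUnit_mul (norm_eq_one_of_mem_primaryComponent hw), map_mul, map_mul,
        ← quaternionJUnit_mul_self]
      group
  inv_mem' := by
    rintro _ ⟨w, hw, rfl | rfl⟩
    · exact ⟨w⁻¹, inv_mem hw, .inl (map_inv _ _).symm⟩
    · refine ⟨w * -1, mul_mem hw neg_one_mem_primaryComponent, .inr ?_⟩
      have hw1 := norm_eq_one_of_mem_primaryComponent hw
      rw [inv_eq_iff_mul_eq_one, mul_assoc, ← mul_assoc quaternionJUnit,
        quaternionJUnit_mul (by simpa using hw1), mul_assoc, quaternionJUnit_mul_self, ← map_mul,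
        ← map_mul]
      simp

/-- This bounds the generated group by two cosets and so supplies the normal form of each element;
`±k` lies in the coset of `j` because `k = i * j`. -/
theorem infiniteGeneralizedQuaternion_le : infiniteGeneralizedQuaternion ≤ twoPowRootsWithJ := by
  rintro u ⟨n, -, hu⟩
  refine (Subgroup.closure_le _).2 ?_ hu
  rintro v (⟨w, hw, hv⟩ | hv)
  · have hw' : w ^ 2 ^ (n - 1) = 1 := hw
    have h0 : w ≠ 0 := by
      rintro rfl
      simp at hw'
    exact ⟨Units.mk0 w h0, mem_primaryComponent_two_iff.2 ⟨n - 1, by ext; simpa using hw'⟩,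
      .inl (by ext1; exact hv.symm)⟩
  · have hI : Units.mk0 Complex.I Complex.I_ne_zero ∈ CommGroup.primaryComponent ℂˣ 2 :=
      mem_primaryComponent_two_iff.2 ⟨2, by ext; simp⟩
    have hneg {x : ℂˣ} (hx : x ∈ CommGroup.primaryComponent ℂˣ 2) :
        -x ∈ CommGroup.primaryComponent ℂˣ 2 := by
      simpa using mul_mem neg_one_mem_primaryComponent hx
    simp only [quaternionEight, Set.mem_insert_iff, Set.mem_singleton_iff] at hv
    rcases hv with h | h | h | h | h | h | h | h
    · exact ⟨1, one_mem _, .inl (by ext1; rw [h]; ext <;> simp)⟩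
    · exact ⟨-1, hneg (one_mem _), .inl (by
        ext1; rw [h]; ext <;> simp [coe_complexUnitsToQuaternion])⟩
    · exact ⟨_, hI, .inl (by
        ext1; rw [h]; ext <;> simp [coe_complexUnitsToQuaternion])⟩
    · exact ⟨_, hneg hI, .inl (by
        ext1; rw [h]; ext <;> simp [coe_complexUnitsToQuaternion])⟩
    · exact ⟨1, one_mem _, .inr (by
        ext1; rw [h]; ext <;> simp [quaternionJUnit])⟩
    · exact ⟨-1, hneg (one_mem _), .inr (by
        ext1; rw [h]
        ext <;> simp [coe_complexUnitsToQuaternion, quaternionJUnit])⟩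
    · exact ⟨_, hI, .inr (by
        ext1; rw [h]
        ext <;> simp [coe_complexUnitsToQuaternion, quaternionJUnit])⟩
    · exact ⟨_, hneg hI, .inr (by
        ext1; rw [h]
        ext <;> simp [coe_complexUnitsToQuaternion, quaternionJUnit])⟩

theorem complexUnitsToQuaternion_mem {w : ℂˣ} (hw : w ∈ CommGroup.primaryComponent ℂˣ 2) :
    complexUnitsToQuaternion w ∈ infiniteGeneralizedQuaternion := by
  obtain ⟨n, hn⟩ := mem_primaryComponent_two_iff.1 hw
  refine ⟨n + 1, by omega, Subgroup.subset_closure (.inl ⟨w, ?_, rfl⟩)⟩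
  change (w : ℂ) ^ 2 ^ n = 1
  simpa using congrArg Units.val hn

theorem quaternionJUnit_mem : quaternionJUnit ∈ infiniteGeneralizedQuaternion :=
  ⟨1, le_rfl, Subgroup.subset_closure (.inr (by simp [quaternionEight, quaternionJUnit]))⟩

/-- The root of unity `exp (2πi / 2 ^ n)`. -/
noncomputable def twoPowRoot (n : ℕ) : ℂˣ :=
  Units.mk0 (Complex.exp (2 * Real.pi * Complex.I / (2 ^ n : ℕ))) (Complex.exp_ne_zero _)

theorem isPrimitiveRoot_twoPowRoot (n : ℕ) : IsPrimitiveRoot (twoPowRoot n) (2 ^ n) :=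
  IsPrimitiveRoot.coe_units_iff.1 (Complex.isPrimitiveRoot_exp (2 ^ n) (by positivity))

theorem twoPowRoot_succ_sq (n : ℕ) : twoPowRoot (n + 1) ^ 2 = twoPowRoot n := by
  ext
  simp only [twoPowRoot, Units.val_pow_eq_pow_val, Units.val_mk0, ← Complex.exp_nat_mul]
  congr 1
  push_cast
  field_simp
  ring

theorem twoPowRoot_one : twoPowRoot 1 = -1 := by
  ext
  simp [twoPowRoot, mul_assoc]

theorem twoPowRoot_mem (n : ℕ) : twoPowRoot n ∈ CommGroup.primaryComponent ℂˣ 2 :=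
  mem_primaryComponent_two_iff.2 ⟨n, (isPrimitiveRoot_twoPowRoot n).pow_eq_one⟩

theorem isInfiniteQuaternion_infiniteGeneralizedQuaternion :
    IsInfiniteQuaternion (G := infiniteGeneralizedQuaternion)
      (fun n => ⟨_, complexUnitsToQuaternion_mem (twoPowRoot_mem n)⟩)
      ⟨_, quaternionJUnit_mem⟩ where
  zero := by
    ext1
    have : twoPowRoot 0 = 1 := by simpa using (isPrimitiveRoot_twoPowRoot 0).pow_eq_one
    simp [this]
  succ_sq n := by
    ext1
    simp only [Subgroup.coe_pow, ← map_pow, twoPowRoot_succ_sq]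
  one_ne h := by
    have h' := congrArg Subtype.val h
    simp only [Subgroup.coe_one, twoPowRoot_one] at h'
    rw [← map_one complexUnitsToQuaternion] at h'
    have := congrArg Units.val (complexUnitsToQuaternion_injective h')
    norm_num at this
  mul_eq n := by
    ext1
    simp only [Subgroup.coe_mul, Subgroup.coe_inv, ← map_inv]
    exact quaternionJUnit_mul (norm_eq_one_of_mem_primaryComponent (twoPowRoot_mem n))
  sq_eq := by
    ext1
    simp only [Subgroup.coe_mul, twoPowRoot_one, quaternionJUnit_mul_self]
  exists_eq := by
    rintro ⟨u, hu⟩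
    obtain ⟨w, hw, h⟩ := infiniteGeneralizedQuaternion_le hu
    obtain ⟨n, hn⟩ := mem_primaryComponent_two_iff.1 hw
    obtain ⟨i, -, hi⟩ := (IsPrimitiveRoot.coe_units_iff.2
      (isPrimitiveRoot_twoPowRoot n)).eq_pow_of_pow_eq_one (by simpa using congrArg Units.val hn)
    obtain rfl : twoPowRoot n ^ i = w := by ext; simpa using hi
    refine ⟨n, i, h.imp (fun h => ?_) fun h => ?_⟩
    · ext1; simp [h]
    · ext1; simp [h]

theorem lemma12 {G : Type*} [Group G] [Infinite G] (h2 : IsPGroup 2 G)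
    (hna : ¬ ∀ a b : G, a * b = b * a) (hu : ∃! x : G, orderOf x = 2) :
    Nonempty (G ≃* infiniteGeneralizedQuaternion) := by
  obtain ⟨z, hz, huniq⟩ := hu
  have hinv : IsUniqueInvolution z :=
    { ne_one := by
        rintro rfl
        simp at hz
      sq := hz ▸ pow_orderOf_eq_one z
      eq_or := fun t ht => or_iff_not_imp_left.2 fun h => huniq t (orderOf_eq_prime ht h) }
  obtain ⟨a, g, h⟩ := hinv.exists_isInfiniteQuaternion h2 hna
  exact h.nonempty_mulEquiv isInfiniteQuaternion_infiniteGeneralizedQuaternion
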